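/- Let $R$ be a regular local ring of characteristic $p>0$, let $t\geq 1$, let $g_1,\dots,g_t\in R$, and let $J=(g_1,\dots,g_t)$. Let $\overline{J}$ denote the integral closure of $J$, that is, the set of all $g\in R$ for which there exist $k\geq 1$ and $s_i\in J^i$ ($i=1,\dots,k$) with $$g^k=s_1g^{k-1}+\cdots+s_ig^{k-i}+\cdots+s_k.$$ If $g\in\overline{J}$, then $g^t\in J$. -/

import Mathlib

/-- The integral closure of an ideal `I` of a commutative ring `R`: the set of all `g` in `R` that
satisfy an equation of integral dependence
`g ^ k = s₁ * g ^ (k - 1) + ⋯ + sᵢ * g ^ (k - i) + ⋯ + sₖ` with `k ≥ 1` and `sᵢ ∈ I ^ i`. -/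
def idealIntegralClosure {R : Type*} [CommRing R] (I : Ideal R) : Set R :=
  {g | ∃ k : ℕ, 0 < k ∧ ∃ s : ℕ → R, (∀ i ∈ Finset.Icc 1 k, s i ∈ I ^ i) ∧
    g ^ k = ∑ i ∈ Finset.Icc 1 k, s i * g ^ (k - i)}

open IsLocalRing RingTheory.Sequence

/-! Write q = p ^ n and I^[q] for the extension of an ideal I along the n-th Frobenius iterate.
Integral dependence gives m with b ^ m * g ^ (t * q) ∈ J ^ (t * q) ⊆ J^[q] for every b ∈ J and every
q, by pigeonhole on the t generators. If g ^ t ∉ J, then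
`IsRegularLocalRing.mem_map_iterateFrobenius_maximalIdeal` puts b ^ m in 𝔪^[q] for all q, so b ^ m =
0 by Krull's intersection theorem. As R is a domain, this is absurd for b ≠ 0. That lemma replaces
flatness of Frobenius by counting lengths. Filtering by socle elements gives ℓ(R/I^[q]) ≤ ℓ(R/𝔪^[q])
ℓ(R/I) for 𝔪-primary I. Equality holds for powers of a regular system of parameters, hence for every
larger ideal, and equality determines the colon ideals. -/

/-! ### Lengths of cyclic modules -/

theorem length_quotient_eq_length_sup_add_length_colon {R : Type*} [CommRing R] (J : Ideal R)
    (x : R) :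
    Module.length R (R ⧸ J) =
      Module.length R (R ⧸ J.colon {x}) + Module.length R (R ⧸ (J ⊔ Ideal.span {x})) := by
  have hle : J.colon {x} ≤ Submodule.comap (LinearMap.mulLeft R x) J := by
    intro a ha
    rw [Submodule.mem_colon_singleton, smul_eq_mul] at ha
    simpa [mul_comm] using ha
  refine Module.length_eq_add_of_exact (Submodule.mapQ (J.colon {x}) J (LinearMap.mulLeft R x) hle)
    (Submodule.factor (le_sup_left : J ≤ J ⊔ Ideal.span {x})) ?_ ?_ ?_
  · rw [← LinearMap.ker_eq_bot, LinearMap.ker_eq_bot']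
    intro a ha
    obtain ⟨a, rfl⟩ := Submodule.Quotient.mk_surjective _ a
    rw [Submodule.mapQ_apply, Submodule.Quotient.mk_eq_zero] at ha
    rw [Submodule.Quotient.mk_eq_zero, Submodule.mem_colon_singleton, smul_eq_mul]
    simpa [mul_comm] using ha
  · exact Submodule.factor_surjective _
  · intro b
    obtain ⟨b, rfl⟩ := Submodule.Quotient.mk_surjective _ b
    change Submodule.factor _ (Submodule.mkQ J b) = 0 ↔ _
    rw [Submodule.factor_mk, Submodule.mkQ_apply, Submodule.Quotient.mk_eq_zero]
    constructor
    · intro hb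
      obtain ⟨j, hj, y, hy, rfl⟩ := Submodule.mem_sup.1 hb
      obtain ⟨z, rfl⟩ := Ideal.mem_span_singleton.1 hy
      refine ⟨Submodule.Quotient.mk z, ?_⟩
      rw [Submodule.mapQ_apply, Submodule.Quotient.eq]
      simpa using hj
    · rintro ⟨z, hz⟩
      obtain ⟨z, rfl⟩ := Submodule.Quotient.mk_surjective _ z
      rw [Submodule.mapQ_apply, Submodule.Quotient.eq] at hz
      have : b = x * z - (x * z - b) := by ring
      rw [this]
      refine Submodule.sub_mem _ (Submodule.mem_sup_right ?_) (Submodule.mem_sup_left hz)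
      exact Ideal.mem_span_singleton.2 (dvd_mul_right _ _)

theorem Ideal.length_quotient_le_of_le {R : Type*} [CommRing R] {I J : Ideal R} (h : I ≤ J) :
    Module.length R (R ⧸ J) ≤ Module.length R (R ⧸ I) :=
  Module.length_le_of_surjective (Submodule.factor h) (Submodule.factor_surjective _)

theorem Ideal.length_quotient_top {R : Type*} [CommRing R] :
    Module.length R (R ⧸ (⊤ : Ideal R)) = 0 := by
  rw [Module.length_eq_zero_iff]
  exact Ideal.Quotient.subsingleton_iff.2 rfl

theorem Ideal.eq_of_le_of_length_quotient_le {R : Type*} [CommRing R] {I J : Ideal R}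
    (h : I ≤ J) (hfin : Module.length R (R ⧸ I) ≠ ⊤)
    (hlen : Module.length R (R ⧸ I) ≤ Module.length R (R ⧸ J)) : J ≤ I := by
  have hex := Module.length_eq_add_of_exact (LinearMap.ker (Submodule.factor h)).subtype
    (Submodule.factor h) (Submodule.subtype_injective _) (Submodule.factor_surjective _)
    (LinearMap.exact_subtype_ker_map _)
  have hJ : Module.length R (R ⧸ J) ≠ ⊤ :=
    ne_top_of_le_ne_top hfin (Ideal.length_quotient_le_of_le h)
  have hz : Module.length R (LinearMap.ker (Submodule.factor h)) = 0 := by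
    have h1 := le_antisymm (Ideal.length_quotient_le_of_le h) hlen
    rw [← h1] at hex
    by_contra hne
    have h2 : 1 ≤ Module.length R (LinearMap.ker (Submodule.factor h)) :=
      Order.one_le_iff_pos.2 (pos_iff_ne_zero.2 hne)
    have h3 : 1 + Module.length R (R ⧸ J) ≤ Module.length R (R ⧸ J) := by
      conv_rhs => rw [hex]
      gcongr
    lift Module.length R (R ⧸ J) to ℕ using hJ with a
    norm_cast at h3
    omega
  rw [Module.length_eq_zero_iff] at hz
  intro a ha
  have : Submodule.Quotient.mk a ∈ LinearMap.ker (Submodule.factor h) := by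
    change Submodule.factor h (Submodule.mkQ I a) = 0
    rw [Submodule.factor_mk]
    exact (Submodule.Quotient.mk_eq_zero J).2 ha
  have h0 := Subsingleton.elim (⟨_, this⟩ : LinearMap.ker (Submodule.factor h)) 0
  have := congrArg Subtype.val h0
  exact (Submodule.Quotient.mk_eq_zero _).1 this

theorem length_quotient_sup_span_pow {R : Type*} [CommRing R] {K : Ideal R} {r : R}
    (h : ∀ a, r * a ∈ K → a ∈ K) (n : ℕ) :
    Module.length R (R ⧸ (K ⊔ Ideal.span {r ^ n})) =
      n * Module.length R (R ⧸ (K ⊔ Ideal.span {r})) := by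
  induction n with
  | zero =>
    have : K ⊔ Ideal.span {r ^ 0} = ⊤ := by simp
    rw [this, Ideal.length_quotient_top]; simp
  | succ n ih =>
    have h1 : (K ⊔ Ideal.span {r ^ (n + 1)}) ⊔ Ideal.span {r} = K ⊔ Ideal.span {r} := by
      rw [sup_assoc]
      congr 1
      rw [sup_eq_right, Ideal.span_singleton_le_span_singleton]
      exact dvd_pow_self r (Nat.succ_ne_zero n)
    have h2 : (K ⊔ Ideal.span {r ^ (n + 1)}).colon {r} = K ⊔ Ideal.span {r ^ n} := by
      ext a
      rw [Submodule.mem_colon_singleton, smul_eq_mul]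
      constructor
      · intro ha
        obtain ⟨k, hk, y, hy, hky⟩ := Submodule.mem_sup.1 ha
        obtain ⟨z, rfl⟩ := Ideal.mem_span_singleton.1 hy
        have : a = (a - r ^ n * z) + r ^ n * z := by ring
        rw [this]
        refine Submodule.add_mem _ (Submodule.mem_sup_left (h _ ?_))
          (Submodule.mem_sup_right (Ideal.mem_span_singleton.2 (dvd_mul_right _ _)))
        have h3 : r * (a - r ^ n * z) = k := by linear_combination -hky
        rwa [h3]
      · intro ha
        obtain ⟨k, hk, y, hy, rfl⟩ := Submodule.mem_sup.1 ha
        obtain ⟨z, rfl⟩ := Ideal.mem_span_singleton.1 hy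
        rw [add_mul]
        refine Submodule.add_mem _ (Submodule.mem_sup_left (Ideal.mul_mem_right _ _ hk))
          (Submodule.mem_sup_right (Ideal.mem_span_singleton.2 ⟨z, by ring⟩))
    rw [length_quotient_eq_length_sup_add_length_colon _ r, h1, h2, ih]
    push_cast
    ring

/-! ### Powers of regular sequences -/

theorem isWeaklyRegular_concat_iff {R : Type*} [CommRing R] (l : List R) (r : R) :
    IsWeaklyRegular R (l ++ [r]) ↔
      IsWeaklyRegular R l ∧ ∀ a, r * a ∈ Ideal.ofList l → a ∈ Ideal.ofList l := by
  rw [isWeaklyRegular_append_iff, isWeaklyRegular_singleton_iff,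
    isSMulRegular_quotient_iff_mem_of_smul_mem]
  simp

theorem Ideal.ofList_perm {R : Type*} [CommRing R] {l₁ l₂ : List R} (h : l₁.Perm l₂) :
    Ideal.ofList l₁ = Ideal.ofList l₂ :=
  congrArg Ideal.span (Set.ext fun _ => h.mem_iff)

theorem IsWeaklyRegular.concat_pow {R : Type*} [CommRing R] {l : List R} {r : R}
    (h : IsWeaklyRegular R (l ++ [r])) (n : ℕ) : IsWeaklyRegular R (l ++ [r ^ n]) := by
  rw [isWeaklyRegular_concat_iff] at h ⊢
  refine ⟨h.1, ?_⟩
  induction n with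
  | zero => simp
  | succ n ih => exact fun a ha => ih a (h.2 _ (by rwa [← mul_assoc, ← pow_succ']))

/-- Regular sequences in 𝔪 may be permuted, so each term can be moved last before being raised to a
power. In the induction `l₂` collects the terms already treated. -/
theorem length_quotient_ofList_map_pow {R : Type*} [CommRing R] [IsLocalRing R] [IsNoetherianRing R]
    {n : ℕ} (hn : n ≠ 0) (l₁ l₂ : List R) (hreg : IsWeaklyRegular R (l₁ ++ l₂))
    (hm : ∀ r ∈ l₁ ++ l₂, r ∈ maximalIdeal R) :
    Module.length R (R ⧸ Ideal.ofList (l₁.map (· ^ n) ++ l₂)) =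
      (n : ℕ∞) ^ l₁.length * Module.length R (R ⧸ Ideal.ofList (l₁ ++ l₂)) := by
  induction l₁ generalizing l₂ with
  | nil =>
    change Module.length R (R ⧸ Ideal.ofList l₂) = _
    simp
  | cons r l₁ ih =>
    have p1 : (r :: l₁ ++ l₂).Perm ((l₁ ++ l₂) ++ [r]) := by
      simpa using (List.perm_append_singleton r (l₁ ++ l₂)).symm
    have p2 : ((l₁ ++ l₂) ++ [r ^ n]).Perm (l₁ ++ (r ^ n :: l₂)) :=
      (List.perm_append_singleton _ _).trans List.perm_middle.symm
    have p3 : ((r :: l₁).map (· ^ n) ++ l₂).Perm (l₁.map (· ^ n) ++ (r ^ n :: l₂)) := by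
      simpa using List.perm_middle.symm
    have h1 : IsWeaklyRegular R ((l₁ ++ l₂) ++ [r]) :=
      IsLocalRing.isWeaklyRegular_of_perm_of_subset_maximalIdeal hreg p1 hm
    have hm1 : ∀ a ∈ (l₁ ++ l₂) ++ [r ^ n], a ∈ maximalIdeal R := by
      intro a ha
      rcases List.mem_append.1 ha with ha | ha
      · exact hm a (List.mem_cons_of_mem _ ha)
      · rw [List.mem_singleton.1 ha]
        exact Ideal.pow_mem_of_mem _ (hm r (by simp)) n (Nat.pos_of_ne_zero hn)
    have h2 := IsLocalRing.isWeaklyRegular_of_perm_of_subset_maximalIdeal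
      (IsWeaklyRegular.concat_pow h1 n) p2 hm1
    rw [Ideal.ofList_perm p3, ih _ h2 (fun a ha => hm1 a (p2.mem_iff.2 ha)),
      Ideal.ofList_perm p2.symm, Ideal.ofList_perm p1, Ideal.ofList_append, Ideal.ofList_append _ [r],
      Ideal.ofList_singleton, Ideal.ofList_singleton,
      length_quotient_sup_span_pow ((isWeaklyRegular_concat_iff _ _).1 h1).2, List.length_cons,
      pow_succ, mul_assoc]

/-! ### Regular local rings: domain property and regular parameters -/

section LocalQuotient
variable {R : Type*} [CommRing R] [IsLocalRing R]

theorem ofList_map_mk_eq_maximalIdeal {x : R} {l : List R}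
    [IsLocalRing (R ⧸ Ideal.span {x})]
    (h : Ideal.ofList (x :: l) = maximalIdeal R) :
    Ideal.ofList (l.map (Ideal.Quotient.mk (Ideal.span {x}))) =
      maximalIdeal (R ⧸ Ideal.span {x}) := by
  rw [← map_maximalIdeal_of_surjective (Ideal.Quotient.mk (Ideal.span {x}))
    Ideal.Quotient.mk_surjective, ← h, Ideal.ofList_cons, Ideal.map_sup, Ideal.map_quotient_self,
    bot_sup_eq, Ideal.map_ofList]

theorem mem_maximalIdeal_of_ofList_cons {x : R} {l : List R}
    (h : Ideal.ofList (x :: l) = maximalIdeal R) : x ∈ maximalIdeal R :=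
  h ▸ Ideal.subset_span (List.mem_cons_self : x ∈ x :: l)

theorem isLocalRing_quotient_span_singleton {x : R} (hx : x ∈ maximalIdeal R) :
    IsLocalRing (R ⧸ Ideal.span {x}) :=
  have : Nontrivial (R ⧸ Ideal.span {x}) := Ideal.Quotient.nontrivial_iff.2 fun h =>
    (maximalIdeal.isMaximal R).ne_top
      (top_le_iff.1 (h ▸ (Ideal.span_singleton_le_iff_mem _).2 hx))
  IsLocalRing.of_surjective' (Ideal.Quotient.mk _) Ideal.Quotient.mk_surjective

variable [IsNoetherianRing R]

theorem le_ringKrullDim_quotient_span_singleton {x : R} (hx : x ∈ maximalIdeal R) {n : ℕ}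
    (hn : ((n + 1 : ℕ) : WithBot ℕ∞) ≤ ringKrullDim R) :
    (n : WithBot ℕ∞) ≤ ringKrullDim (R ⧸ Ideal.span {x}) := by
  have h := Ideal.height_le_ringKrullDim_quotient_add_one hx
  rw [maximalIdeal_height_eq_ringKrullDim] at h
  have h2 := hn.trans h
  push_cast at h2
  exact ENat.WithBot.add_le_add_one_right_iff.1 h2

theorem exists_ofList_cons_eq_maximalIdeal {x : R} {l : List R}
    (hl : Ideal.ofList l = maximalIdeal R) (hx : x ∈ maximalIdeal R)
    (hx2 : x ∉ maximalIdeal R ^ 2) :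
    ∃ l' : List R, l'.length + 1 = l.length ∧ Ideal.ofList (x :: l') = maximalIdeal R := by
  -- Exchange: the first generator with a unit coefficient in x is replaced by x, using Nakayama.
  -- Those passed over, in `l₂`, contribute only to 𝔪².
  have key : ∀ (l₁ l₂ : List R), (l₁ ++ l₂).Perm l → x ∈ maximalIdeal R ^ 2 ⊔ Ideal.ofList l₁ →
      ∃ l' : List R, l'.length + 1 = l.length ∧ Ideal.ofList (x :: l') = maximalIdeal R := by
    intro l₁
    induction l₁ with
    | nil => intro l₂ _ h; exact absurd (by simpa using h) hx2
    | cons y l₁ ih =>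
      intro l₂ hp h
      have hpm : Ideal.ofList (y :: l₁ ++ l₂) = maximalIdeal R := (Ideal.ofList_perm hp).trans hl
      rw [Ideal.ofList_cons, ← sup_assoc, sup_right_comm] at h
      obtain ⟨a, ha, b, hb, hab⟩ := Submodule.mem_sup.1 h
      obtain ⟨u, rfl⟩ := Ideal.mem_span_singleton.1 hb
      by_cases hu : IsUnit u
      · refine ⟨l₁ ++ l₂, by rw [← hp.length_eq]; simp, ?_⟩
        have hle : Ideal.ofList (x :: (l₁ ++ l₂)) ≤ maximalIdeal R := by
          rw [Ideal.ofList_cons, sup_le_iff, Ideal.span_singleton_le_iff_mem]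
          refine ⟨hx, ?_⟩
          rw [← hpm, List.cons_append, Ideal.ofList_cons]
          exact le_sup_right
        refine le_antisymm hle ?_
        refine Submodule.le_of_le_smul_of_le_jacobson_bot (I := maximalIdeal R)
          (IsNoetherian.noetherian _) (maximalIdeal_le_jacobson _) ?_
        rw [smul_eq_mul, ← pow_two]
        conv_lhs => rw [← hpm, List.cons_append, Ideal.ofList_cons]
        rw [sup_le_iff, Ideal.span_singleton_le_iff_mem]
        constructor
        · obtain ⟨v, hv⟩ := hu.exists_right_inv
          have : y = v * (x - a) := by rw [← hab]; linear_combination -y * hv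
          rw [this]
          refine Ideal.mul_mem_left _ _ (Submodule.sub_mem _ ?_ ?_)
          · exact Submodule.mem_sup_left (Ideal.subset_span (by simp))
          · refine (sup_le (le_sup_right) ?_ : maximalIdeal R ^ 2 ⊔ Ideal.ofList l₁ ≤ _) ha
            rw [Ideal.ofList_cons, Ideal.ofList_append]
            exact (le_sup_left.trans le_sup_right).trans le_sup_left
        · rw [Ideal.ofList_cons]
          exact le_sup_right.trans le_sup_left
      · refine ih (y :: l₂) (List.perm_middle.trans hp) ?_
        rw [← hab]
        refine Submodule.add_mem _ ha (Submodule.mem_sup_left ?_)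
        rw [pow_two]
        exact Ideal.mul_mem_mul (mem_maximalIdeal_of_ofList_cons hpm) ((mem_maximalIdeal _).2 hu)
  exact key l [] (by simp) (Submodule.mem_sup_right (hl ▸ hx))

end LocalQuotient

/-- Prime avoidance gives x ∈ 𝔪 outside 𝔪² and all minimal primes. By induction (x) is prime, so it
contains a minimal prime P. Since x ∉ P, P = xP, and Nakayama gives P = 0. -/
theorem isDomain_of_ofList_eq_maximalIdeal (n : ℕ) :
    ∀ {R : Type*} [CommRing R] [IsLocalRing R] [IsNoetherianRing R] (l : List R),
      l.length = n → Ideal.ofList l = maximalIdeal R → (n : WithBot ℕ∞) ≤ ringKrullDim R →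
      IsDomain R := by
  induction n with
  | zero =>
    intro R _ _ _ l hl hm _
    rw [List.length_eq_zero_iff.1 hl, Ideal.ofList_nil] at hm
    exact (isField_iff_maximalIdeal_eq.2 hm.symm).isDomain
  | succ n ih =>
    intro R _ _ _ l hl hm hd
    have hht : (maximalIdeal R).height ≠ 0 := by
      intro h0
      rw [← maximalIdeal_height_eq_ringKrullDim, h0] at hd
      norm_cast at hd
    have hfin := minimalPrimes.finite_of_isNoetherianRing R
    obtain ⟨x, hx, hx2, hxP⟩ : ∃ x ∈ maximalIdeal R, x ∉ maximalIdeal R ^ 2 ∧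
        ∀ P ∈ minimalPrimes R, x ∉ P := by
      by_contra! hcon
      have hsub : ((maximalIdeal R : Ideal R) : Set R) ⊆
          ⋃ i ∈ ((insert (maximalIdeal R ^ 2) hfin.toFinset : Finset (Ideal R)) : Set (Ideal R)),
            ((id i : Ideal R) : Set R) := by
        intro x hx
        by_cases hx2 : x ∈ maximalIdeal R ^ 2
        · exact Set.mem_biUnion (by simp) hx2
        · obtain ⟨P, hP, hxP⟩ := hcon x hx hx2
          exact Set.mem_biUnion (by simp [hP]) hxP
      rw [Ideal.subset_union_prime (maximalIdeal R ^ 2) (maximalIdeal R ^ 2)] at hsub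
      · obtain ⟨I, hI, hle⟩ := hsub
        rcases Finset.mem_insert.1 hI with rfl | hI
        · have : maximalIdeal R = ⊥ :=
            Submodule.eq_bot_of_le_smul_of_le_jacobson_bot (maximalIdeal R) _
              (IsNoetherian.noetherian _) (by rw [smul_eq_mul, ← pow_two]; exact hle)
              (maximalIdeal_le_jacobson _)
          have h0 := ringKrullDim_eq_zero_of_isField (isField_iff_maximalIdeal_eq.2 this)
          rw [← maximalIdeal_height_eq_ringKrullDim] at h0
          exact hht (by exact_mod_cast h0)
        · rw [Set.Finite.mem_toFinset] at hI
          have hIp := Ideal.IsMinimalPrime.isPrime hI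
          have := le_antisymm hle (le_maximalIdeal hIp.ne_top)
          exact hht (Ideal.height_eq_zero_iff.2 (this ▸ hI))
      · intro I hI h1 _
        rcases Finset.mem_insert.1 hI with rfl | hI
        · exact absurd rfl h1
        · have hIm := (Set.Finite.mem_toFinset hfin).1 hI
          exact Ideal.IsMinimalPrime.isPrime hIm
    obtain ⟨l', hl', hm'⟩ := exists_ofList_cons_eq_maximalIdeal hm hx hx2
    have : IsLocalRing (R ⧸ Ideal.span {x}) := isLocalRing_quotient_span_singleton hx
    have hdom : IsDomain (R ⧸ Ideal.span {x}) :=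
      ih (l'.map (Ideal.Quotient.mk _)) (by rw [List.length_map]; omega)
        (ofList_map_mk_eq_maximalIdeal hm') (le_ringKrullDim_quotient_span_singleton hx hd)
    have hprime : (Ideal.span {x}).IsPrime := (Ideal.Quotient.isDomain_iff_prime _).1 hdom
    obtain ⟨P, hP, hPx⟩ := Ideal.exists_minimalPrimes_le (bot_le : ⊥ ≤ Ideal.span {x})
    have hPp : P.IsPrime := Ideal.IsMinimalPrime.isPrime hP
    have hPbot : P = ⊥ := by
      refine Submodule.eq_bot_of_le_smul_of_le_jacobson_bot (maximalIdeal R) _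
        (IsNoetherian.noetherian _) ?_ (maximalIdeal_le_jacobson _)
      intro a ha
      obtain ⟨b, rfl⟩ := Ideal.mem_span_singleton.1 (hPx ha)
      exact Ideal.mul_mem_mul hx ((hPp.mem_or_mem ha).resolve_left (hxP P hP))
    exact IsDomain.of_bot_isPrime R (hbp := hPbot ▸ hPp)

theorem isWeaklyRegular_of_ofList_eq_maximalIdeal (n : ℕ) :
    ∀ {R : Type*} [CommRing R] [IsLocalRing R] [IsNoetherianRing R] (l : List R),
      l.length = n → Ideal.ofList l = maximalIdeal R → (n : WithBot ℕ∞) ≤ ringKrullDim R →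
      IsWeaklyRegular R l := by
  induction n with
  | zero =>
    intro R _ _ _ l hl _ _
    rw [List.length_eq_zero_iff.1 hl]
    exact .nil R R
  | succ n ih =>
    intro R _ _ _ l hl hm hd
    have hdom := isDomain_of_ofList_eq_maximalIdeal (n + 1) l hl hm hd
    match l, hl with
    | x :: l, hl =>
      have hx := mem_maximalIdeal_of_ofList_cons hm
      have : IsLocalRing (R ⧸ Ideal.span {x}) := isLocalRing_quotient_span_singleton hx
      have h1 := ih (l.map (Ideal.Quotient.mk (Ideal.span {x}))) (by simpa using hl)
        (ofList_map_mk_eq_maximalIdeal hm) (le_ringKrullDim_quotient_span_singleton hx hd)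
      rw [← Ideal.Quotient.algebraMap_eq, isWeaklyRegular_map_algebraMap_iff] at h1
      rw [isWeaklyRegular_cons_iff]
      constructor
      -- If x = 0, the n remaining generators would already generate 𝔪, against dimension at least n
      -- + 1.
      · have hx0 : x ≠ 0 := by
          classical
          rintro rfl
          have h2 := hd.trans (ringKrullDim_le_spanFinrank_maximalIdeal R)
          rw [← hm, Ideal.ofList_cons, Ideal.span_singleton_eq_bot.2 rfl, bot_sup_eq] at h2
          have h3 : (Ideal.ofList l).spanFinrank ≤ {a | a ∈ l}.ncard :=
            Submodule.spanFinrank_span_le_ncard_of_finite (List.finite_toSet l)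
          have h4 : {a | a ∈ l}.ncard ≤ l.length := by
            rw [← List.coe_toFinset, Set.ncard_coe_finset]
            exact List.toFinset_card_le l
          rw [List.length_cons] at hl
          norm_cast at h2
          omega
        intro a b hab
        exact mul_left_cancel₀ hx0 hab
      · refine (LinearEquiv.isWeaklyRegular_congr (Submodule.quotEquivOfEq _ _ ?_) l).2 h1
        rw [← Submodule.ideal_span_singleton_smul]
        simp

theorem IsRegularLocalRing.exists_isWeaklyRegular (R : Type*) [CommRing R] [IsRegularLocalRing R] :
    IsDomain R ∧ ∃ l : List R, IsWeaklyRegular R l ∧ Ideal.ofList l = maximalIdeal R := by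
  have hfin := Submodule.FG.finite_generators (IsNoetherian.noetherian (maximalIdeal R))
  set l := hfin.toFinset.toList with hldef
  have hl : l.length = (maximalIdeal R).spanFinrank := by
    rw [hldef, Finset.length_toList, ← Set.ncard_eq_toFinset_card _ hfin,
      Submodule.FG.generators_ncard (IsNoetherian.noetherian _)]
  have hm : Ideal.ofList l = maximalIdeal R := by
    conv_rhs => rw [← Submodule.span_generators (maximalIdeal R)]
    refine congrArg Ideal.span (Set.ext fun a => ?_)
    simp [hldef]
  have hd : ((maximalIdeal R).spanFinrank : WithBot ℕ∞) ≤ ringKrullDim R :=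
    IsRegularLocalRing.spanFinrank_maximalIdeal.le
  exact ⟨isDomain_of_ofList_eq_maximalIdeal _ l hl hm hd, l,
    isWeaklyRegular_of_ofList_eq_maximalIdeal _ l hl hm hd, hm⟩

/-! ### Krull intersection and socle elements -/

theorem IsLocalRing.exists_notMem_sup_maximalIdeal_pow {R : Type*} [CommRing R] [IsLocalRing R]
    [IsNoetherianRing R] {J : Ideal R} {x : R} (hx : x ∉ J) : ∃ n, x ∉ J ⊔ maximalIdeal R ^ n := by
  by_contra! h
  refine hx ((Submodule.Quotient.mk_eq_zero J).1 ?_)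
  rw [← Submodule.mem_bot R, ← Ideal.iInf_pow_smul_eq_bot_of_isLocalRing (M := R ⧸ J)
    (maximalIdeal R) (maximalIdeal.isMaximal R).ne_top, Submodule.mem_iInf]
  intro n
  obtain ⟨a, ha, b, hb, rfl⟩ := Submodule.mem_sup.1 (h n)
  have : (Submodule.Quotient.mk (a + b) : R ⧸ J) = b • Submodule.Quotient.mk 1 := by
    rw [← Submodule.Quotient.mk_smul, smul_eq_mul, mul_one, Submodule.Quotient.eq]
    simpa using ha
  rw [this]
  exact Submodule.smul_mem_smul hb trivial

theorem Ideal.exists_mem_notMem_forall_mul_mem {R : Type*} [CommRing R] {m J J' : Ideal R}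
    {N : ℕ} (hN : m ^ N ≤ J) (h : ¬ J' ≤ J) :
    ∃ x ∈ J', x ∉ J ∧ ∀ a ∈ m, a * x ∈ J := by
  obtain ⟨k, hk, hk'⟩ : ∃ k, m ^ (k + 1) * J' ≤ J ∧ ¬ m ^ k * J' ≤ J := by
    by_contra! hcon
    have hall : ∀ k ≤ N, m ^ (N - k) * J' ≤ J := by
      intro k
      induction k with
      | zero => exact fun _ => Ideal.mul_le_left.trans hN
      | succ k ih =>
        intro hk
        by_contra hc
        refine absurd (ih (by omega)) fun h' => hc (hcon _ ?_)
        rwa [show N - (k + 1) + 1 = N - k by omega]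
    exact h (by simpa using hall N le_rfl)
  obtain ⟨x, hx, hxJ⟩ := SetLike.not_le_iff_exists.1 hk'
  refine ⟨x, Ideal.mul_le_right hx, hxJ, fun a ha => hk ?_⟩
  rw [pow_succ', mul_assoc]
  exact Ideal.mul_mem_mul ha hx

theorem length_quotient_eq_length_sup_add_one {R : Type*} [CommRing R] [IsLocalRing R]
    {J : Ideal R} {x : R} (hx : x ∉ J) (hm : ∀ a ∈ maximalIdeal R, a * x ∈ J) :
    Module.length R (R ⧸ J) = 1 + Module.length R (R ⧸ (J ⊔ Ideal.span {x})) := by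
  have h : J.colon {x} = maximalIdeal R := by
    refine le_antisymm (le_maximalIdeal fun h => hx ?_) fun a ha => ?_
    · have h1 : (1 : R) ∈ J.colon {x} := h ▸ trivial
      simpa [Submodule.mem_colon_singleton] using h1
    · simpa [Submodule.mem_colon_singleton] using hm a ha
  rw [length_quotient_eq_length_sup_add_length_colon J x, h]
  congr 1
  rw [Module.length_eq_one_iff, isSimpleModule_iff_isCoatom]
  exact Ideal.isMaximal_def.1 inferInstance

/-! ### Lengths under Frobenius -/

section Frobenius

variable {R : Type*} [CommRing R] (p e : ℕ) [ExpChar R p]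

theorem Ideal.map_iterateFrobenius_sup_span_singleton (J : Ideal R) (x : R) :
    (J ⊔ Ideal.span {x}).map (iterateFrobenius R p e) =
      J.map (iterateFrobenius R p e) ⊔ Ideal.span {x ^ p ^ e} := by
  rw [Ideal.map_sup, Ideal.map_span, Set.image_singleton, iterateFrobenius_def]

theorem Ideal.map_iterateFrobenius_ofList_map_pow (l : List R) (n : ℕ) :
    (Ideal.ofList (l.map (· ^ n))).map (iterateFrobenius R p e) =
      Ideal.ofList (l.map (· ^ (n * p ^ e))) := by
  rw [Ideal.map_ofList, List.map_map]
  congr 2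
  funext a
  simp [iterateFrobenius_def, pow_mul]

variable [IsLocalRing R]

theorem Ideal.map_iterateFrobenius_maximalIdeal_le_colon {J : Ideal R} {x : R}
    (hm : ∀ a ∈ maximalIdeal R, a * x ∈ J) :
    (maximalIdeal R).map (iterateFrobenius R p e) ≤
      (J.map (iterateFrobenius R p e)).colon {x ^ p ^ e} := by
  rw [Ideal.map_le_iff_le_comap]
  intro a ha
  rw [Ideal.mem_comap, Submodule.mem_colon_singleton, iterateFrobenius_def, smul_eq_mul,
    ← mul_pow, ← iterateFrobenius_def]
  exact Ideal.mem_map_of_mem _ (hm a ha)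

variable [IsNoetherianRing R]

/-- Adjoining a socle element x to J lowers ℓ(R/J) by 1. It lowers ℓ(R/J^[q]) by the colength of
J^[q] : x^q, which contains 𝔪^[q]. -/
theorem length_quotient_map_iterateFrobenius_le {N : ℕ} (J : Ideal R)
    (hN : maximalIdeal R ^ N ≤ J) :
    Module.length R (R ⧸ J.map (iterateFrobenius R p e)) ≤
      Module.length R (R ⧸ (maximalIdeal R).map (iterateFrobenius R p e)) *
        Module.length R (R ⧸ J) := by
  induction J using WellFoundedGT.induction with
  | ind J ih =>
    by_cases hJ : J = ⊤
    · rw [hJ, Ideal.map_top, Ideal.length_quotient_top]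
      exact zero_le
    · obtain ⟨x, -, hx, hm⟩ := Ideal.exists_mem_notMem_forall_mul_mem (J' := ⊤) hN
        (fun h => hJ (top_le_iff.1 h))
      have hlt : J < J ⊔ Ideal.span {x} :=
        left_lt_sup.2 (by rwa [Ideal.span_singleton_le_iff_mem])
      have h1 := ih _ hlt (hN.trans hlt.le)
      rw [length_quotient_eq_length_sup_add_length_colon _ (x ^ p ^ e),
        ← Ideal.map_iterateFrobenius_sup_span_singleton,
        length_quotient_eq_length_sup_add_one hx hm, mul_add, mul_one]
      exact add_le_add (Ideal.length_quotient_le_of_le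
        (Ideal.map_iterateFrobenius_maximalIdeal_le_colon p e hm)) h1

/-- The lower bound survives each socle step from J up to J': the left side drops by exactly
ℓ(R/𝔪^[q]), the right side by at most that. -/
theorem le_length_quotient_map_iterateFrobenius {N : ℕ} {J' : Ideal R}
    (he : Module.length R (R ⧸ (maximalIdeal R).map (iterateFrobenius R p e)) ≠ ⊤) (J : Ideal R)
    (hN : maximalIdeal R ^ N ≤ J) (hJJ' : J ≤ J')
    (hJ : Module.length R (R ⧸ (maximalIdeal R).map (iterateFrobenius R p e)) *
        Module.length R (R ⧸ J) ≤ Module.length R (R ⧸ J.map (iterateFrobenius R p e))) :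
    Module.length R (R ⧸ (maximalIdeal R).map (iterateFrobenius R p e)) *
        Module.length R (R ⧸ J') ≤ Module.length R (R ⧸ J'.map (iterateFrobenius R p e)) := by
  induction J using WellFoundedGT.induction with
  | ind J ih =>
    by_cases hle : J' ≤ J
    · rwa [le_antisymm hle hJJ']
    · obtain ⟨x, hxJ', hx, hm⟩ := Ideal.exists_mem_notMem_forall_mul_mem hN hle
      have hlt : J < J ⊔ Ideal.span {x} :=
        left_lt_sup.2 (by rwa [Ideal.span_singleton_le_iff_mem])
      refine ih _ hlt (hN.trans hlt.le)
        (sup_le hJJ' ((Ideal.span_singleton_le_iff_mem _).2 hxJ')) ?_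
      rw [length_quotient_eq_length_sup_add_length_colon (J.map _) (x ^ p ^ e),
        ← Ideal.map_iterateFrobenius_sup_span_singleton,
        length_quotient_eq_length_sup_add_one hx hm, mul_add, mul_one] at hJ
      refine (ENat.add_le_add_iff_left he).1 (hJ.trans ?_)
      gcongr
      exact Ideal.length_quotient_le_of_le
        (Ideal.map_iterateFrobenius_maximalIdeal_le_colon p e hm)

end Frobenius

theorem IsRegularLocalRing.mem_map_iterateFrobenius_maximalIdeal {R : Type*} [CommRing R]
    [IsRegularLocalRing R] (p e : ℕ) [ExpChar R p] {J : Ideal R} {x c : R} (hx : x ∉ J)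
    (hc : c * x ^ p ^ e ∈ J.map (iterateFrobenius R p e)) :
    c ∈ (maximalIdeal R).map (iterateFrobenius R p e) := by
  obtain ⟨-, l, hreg, hl⟩ := IsRegularLocalRing.exists_isWeaklyRegular R
  obtain ⟨n, hn⟩ := IsLocalRing.exists_notMem_sup_maximalIdeal_pow hx
  have hn0 : n ≠ 0 := by
    rintro rfl
    simp at hn
  have hq : p ^ e ≠ 0 := (pow_pos (expChar_pos R p) e).ne'
  have hlm : ∀ r ∈ l, r ∈ maximalIdeal R := fun r hr => hl ▸ Ideal.subset_span hr
  have hone : Module.length R (R ⧸ maximalIdeal R) = 1 := by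
    rw [Module.length_eq_one_iff, isSimpleModule_iff_isCoatom]
    exact Ideal.isMaximal_def.1 inferInstance
  have hlen : ∀ a : ℕ, a ≠ 0 →
      Module.length R (R ⧸ Ideal.ofList (l.map (· ^ a))) = (a : ℕ∞) ^ l.length := by
    intro a ha
    have h := length_quotient_ofList_map_pow ha l [] (by simpa using hreg) (by simpa using hlm)
    rw [List.append_nil, List.append_nil, hl, hone, mul_one] at h
    exact h
  set I := Ideal.ofList (l.map (· ^ n)) with hI
  have hIn : I ≤ maximalIdeal R ^ n := by
    refine Ideal.span_le.2 fun a ha => ?_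
    obtain ⟨b, hb, rfl⟩ := List.mem_map.1 ha
    exact Ideal.pow_mem_pow (hlm b hb) n
  obtain ⟨N, hN⟩ : ∃ N, maximalIdeal R ^ N ≤ I := by
    refine Ideal.exists_pow_le_of_le_radical_of_fg ?_ (IsNoetherian.noetherian _)
    rw [← hl]
    exact Ideal.span_le.2 fun a ha => ⟨n, Ideal.subset_span (List.mem_map_of_mem ha)⟩
  have hFm : (maximalIdeal R).map (iterateFrobenius R p e) = Ideal.ofList (l.map (· ^ p ^ e)) := by
    have h := Ideal.map_iterateFrobenius_ofList_map_pow p e l 1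
    simpa [hl] using h
  have hFlen : Module.length R (R ⧸ (maximalIdeal R).map (iterateFrobenius R p e)) =
      ((p ^ e : ℕ) : ℕ∞) ^ l.length := by
    rw [hFm, hlen _ hq]
  have hfin : Module.length R (R ⧸ (maximalIdeal R).map (iterateFrobenius R p e)) ≠ ⊤ := by
    rw [hFlen]
    exact_mod_cast ENat.natCast_ne_top _
  have hIlen : Module.length R (R ⧸ (maximalIdeal R).map (iterateFrobenius R p e)) *
      Module.length R (R ⧸ I) ≤ Module.length R (R ⧸ I.map (iterateFrobenius R p e)) := by
    rw [hFlen, hI, Ideal.map_iterateFrobenius_ofList_map_pow, hlen n hn0,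
      hlen _ (mul_ne_zero hn0 hq), Nat.cast_mul, mul_pow, mul_comm]
  have hxK : x ∉ J ⊔ I := fun h => hn (sup_le_sup_left hIn J h)
  have hNK : maximalIdeal R ^ N ≤ J ⊔ I := hN.trans le_sup_right
  -- Modulo J ⊔ I some multiple x * r is a nonzero socle element.
  obtain ⟨y, hy, hyK, hym⟩ := Ideal.exists_mem_notMem_forall_mul_mem
    (J' := (J ⊔ I) ⊔ Ideal.span {x}) hNK
    (fun h => hxK (h (Submodule.mem_sup_right (Ideal.mem_span_singleton_self x))))
  obtain ⟨k, hk, z, hz, rfl⟩ := Submodule.mem_sup.1 hy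
  obtain ⟨r, rfl⟩ := Ideal.mem_span_singleton.1 hz
  have hrK : x * r ∉ J ⊔ I := fun h => hyK (Submodule.add_mem _ hk h)
  have hrm : ∀ a ∈ maximalIdeal R, a * (x * r) ∈ J ⊔ I := fun a ha => by
    have := Submodule.sub_mem _ (hym a ha) (Ideal.mul_mem_left _ a hk)
    rwa [mul_add, add_sub_cancel_left] at this
  have hKlt : J ⊔ I ≤ (J ⊔ I) ⊔ Ideal.span {x * r} := le_sup_left
  have hlow := le_length_quotient_map_iterateFrobenius p e hfin I hN
    (le_sup_right : I ≤ J ⊔ I) hIlen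
  have hup := length_quotient_map_iterateFrobenius_le p e _ (hNK.trans hKlt)
  have hIfin : Module.length R (R ⧸ I) ≠ ⊤ := by
    rw [hI, hlen n hn0]
    exact_mod_cast ENat.natCast_ne_top _
  have hK'fin := ne_top_of_le_ne_top hIfin (Ideal.length_quotient_le_of_le
    (le_sup_right.trans hKlt : I ≤ (J ⊔ I) ⊔ Ideal.span {x * r}))
  rw [length_quotient_eq_length_sup_add_one hrK hrm,
    length_quotient_eq_length_sup_add_length_colon ((J ⊔ I).map _) ((x * r) ^ p ^ e),
    ← Ideal.map_iterateFrobenius_sup_span_singleton, mul_add, mul_one] at hlow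
  -- The lower bound for J ⊔ I and the upper bound after adjoining x * r leave the colon ideal with
  -- colength at least that of 𝔪^[q], which it contains; hence the two agree.
  have hle := (ENat.add_le_add_iff_right (WithTop.mul_ne_top hfin hK'fin)).1
    (hlow.trans (add_le_add_right hup _))
  refine Ideal.eq_of_le_of_length_quotient_le
    (Ideal.map_iterateFrobenius_maximalIdeal_le_colon p e hrm) hfin hle ?_
  rw [Submodule.mem_colon_singleton, smul_eq_mul]
  have : c * (x * r) ^ p ^ e = r ^ p ^ e * (c * x ^ p ^ e) := by ring
  rw [this]
  exact Ideal.mul_mem_left _ _ (Ideal.map_mono le_sup_left hc)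

/-! ### Integral dependence and the conclusion -/

theorem Ideal.span_image_pow_card_mul_le {R ι : Type*} [CommRing R] (s : Finset ι) (f : ι → R)
    (n : ℕ) (hs : s.Nonempty) :
    Ideal.span (f '' s) ^ (s.card * n) ≤ Ideal.span ((fun i => f i ^ n) '' s) := by
  classical
  induction hs using Finset.Nonempty.cons_induction with
  | singleton a => simp [Ideal.span_singleton_pow]
  | cons a s ha hs ih =>
    rw [Finset.card_cons, Finset.coe_cons, Set.image_insert_eq, Set.image_insert_eq,
      Ideal.span_insert, Ideal.span_insert, add_mul, one_mul, add_comm]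
    refine Ideal.sup_pow_add_le_pow_sup_pow.trans (sup_le_sup ?_ ih)
    rw [Ideal.span_singleton_pow]

theorem idealIntegralClosure.exists_pow_mem {R : Type*} [CommRing R] {J : Ideal R} {g : R}
    (hg : g ∈ idealIntegralClosure J) : ∃ m : ℕ, ∀ n, g ^ n ∈ J ^ (n - m) := by
  obtain ⟨k, hk, s, hs, hgk⟩ := hg
  refine ⟨k, fun n => ?_⟩
  induction n using Nat.strong_induction_on with
  | _ n ih =>
    rcases lt_or_ge n k with hnk | hnk
    · rw [Nat.sub_eq_zero_of_le hnk.le]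
      simp
    · rw [← Nat.sub_add_cancel hnk, pow_add, hgk, Finset.mul_sum]
      refine Submodule.sum_mem _ fun i hi => ?_
      have hi' := Finset.mem_Icc.1 hi
      have h1 : g ^ (n - k) * (s i * g ^ (k - i)) = s i * g ^ (n - i) := by
        rw [show n - i = (n - k) + (k - i) by omega, pow_add]
        ring
      rw [h1]
      refine Ideal.pow_le_pow_right ?_ (pow_add J i (n - i - k) ▸
        Ideal.mul_mem_mul (hs i hi) (ih (n - i) (by omega)))
      omega

theorem mainTheorem2 {R : Type*} [CommRing R] [IsRegularLocalRing R]
    (p : ℕ) (hp : 0 < p) [CharP R p]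
    (t : ℕ) (ht : 0 < t) (gs : Fin t → R) (J : Ideal R) (hJ : J = Ideal.span (Set.range gs))
    (g : R) (hg : g ∈ idealIntegralClosure J) :
    g ^ t ∈ J := by
  obtain ⟨hdom, -⟩ := IsRegularLocalRing.exists_isWeaklyRegular R
  have hprime : p.Prime := (CharP.char_is_prime_or_zero R p).resolve_right hp.ne'
  have : ExpChar R p := ExpChar.prime hprime
  obtain ⟨m, hm⟩ := idealIntegralClosure.exists_pow_mem hg
  by_cases hJ0 : J = ⊥
  · have h := hm (m + 1)
    rw [hJ0, Nat.add_sub_cancel_left, pow_one, Ideal.mem_bot] at h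
    rw [(pow_eq_zero_iff (Nat.succ_ne_zero m)).1 h, zero_pow ht.ne']
    exact J.zero_mem
  · obtain ⟨b, hb, hb0⟩ := Submodule.exists_mem_ne_zero_of_ne_bot hJ0
    by_contra hgt
    refine pow_ne_zero m hb0 ?_
    rw [← Ideal.mem_bot, ← Ideal.iInf_pow_eq_bot_of_isLocalRing (maximalIdeal R)
      (maximalIdeal.isMaximal R).ne_top, Submodule.mem_iInf]
    intro n
    have hFrob : J ^ (t * p ^ n) ≤ J.map (iterateFrobenius R p n) := by
      have : Nonempty (Fin t) := ⟨⟨0, ht⟩⟩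
      have h := Ideal.span_image_pow_card_mul_le Finset.univ gs (p ^ n) Finset.univ_nonempty
      rw [hJ, Ideal.map_span, ← Set.range_comp]
      simpa [Set.image_univ, Function.comp_def, iterateFrobenius_def] using h
    have hmem : b ^ m * (g ^ t) ^ p ^ n ∈ J.map (iterateFrobenius R p n) := by
      -- Subtraction is truncated, so the exponent is at least t * p ^ n even when m is larger.
      refine hFrob (Ideal.pow_le_pow_right (m := t * p ^ n) (n := m + (t * p ^ n - m)) (by omega) ?_)
      rw [← pow_mul, pow_add]
      exact Ideal.mul_mem_mul (Ideal.pow_mem_pow hb m) (hm _)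
    -- 𝔪^[q] ⊆ 𝔪 ^ q ⊆ 𝔪 ^ n, because n < p ^ n = q.
    refine Ideal.pow_le_pow_right (Nat.lt_pow_self hprime.one_lt).le (?_ : _ ∈ _ ^ (p ^ n))
    refine (Ideal.map_le_iff_le_comap.2 fun a ha => ?_)
      (IsRegularLocalRing.mem_map_iterateFrobenius_maximalIdeal p n hgt hmem)
    rw [Ideal.mem_comap, iterateFrobenius_def]
    exact Ideal.pow_mem_pow ha _
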